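/- A packing $k$-coloring of a graph $X$ is a map $c\colon V(X)\to\{1,\dots,k\}$ such that $c(u)=c(v)=\ell$ with $u\neq v$ implies $d_X(u,v)>\ell$; the packing chromatic number $\chi_\rho(X)$ is the smallest $k$ for which $X$ has a packing $k$-coloring. For graphs $G,H$ and a function $f\colon V(G)\to V(H)$, the Sierpiński product $G\otimes_f H$ is the graph on $V(G)\times V(H)$ whose edges are $(g,h)(g,h')$ for $g\in V(G)$, $hh'\in E(H)$, and $(g,f(g'))(g',f(g))$ for $gg'\in E(G)$. The Sierpiński packing chromatic number and the upper Sierpiński packing chromatic number of $(G,H)$ are $$\chi_\rho(G,H)=\min_{f\colon V(G)\to V(H)}\chi_\rho(G\otimes_f H),\qquad \widehat{\chi}_\rho(G,H)=\max_{f\colon V(G)\to V(H)}\chi_\rho(G\otimes_f H).$$ **Theorem.** Let $P_m$ be the path on $m$ vertices and $K_{1,n}$ the star with $n$ leaves. If $m\ge 2$ and $n\ge 3$, then $\chi_\rho(P_m,K_{1,n})=3$ and $\widehat{\chi}_\rho(P_m,K_{1,n})\le 9$. Moreover, if $n=3$ and $m\ge 10$, then $\widehat{\chi}_\rho(P_m,K_{1,n})\in\{6,7,8,9\}$,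 and if $n>3$ and $m\ge 35$, then $\widehat{\chi}_\rho(P_m,K_{1,n})\in\{7,8,9\}$. -/

import Mathlib

namespace SimpleGraph

variable {V W : Type*}

/-- The Sierpiński product `G ⊗_f H` on `V × W`: a copy of `H` for every vertex of `G`, and for
every edge `gg'` of `G` the connecting edge `(g, f g')(g', f g)`. -/
def sierpinskiProduct (G : SimpleGraph V) (H : SimpleGraph W) (f : V → W) :
    SimpleGraph (V × W) where
  Adj x y := (x.1 = y.1 ∧ H.Adj x.2 y.2) ∨ (G.Adj x.1 y.1 ∧ x.2 = f y.1 ∧ y.2 = f x.1)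
  symm := ⟨by
    rintro x y (⟨h, h'⟩ | ⟨h, h₁, h₂⟩)
    · exact Or.inl ⟨h.symm, h'.symm⟩
    · exact Or.inr ⟨h.symm, h₂, h₁⟩⟩
  loopless := ⟨by
    rintro x (⟨-, h⟩ | ⟨h, -⟩)
    · exact H.irrefl h
    · exact G.irrefl h⟩

/-- `c` is a packing `k`-coloring of `G`: it takes values in `{1, …, k}`, and two distinct vertices
of the same color `ℓ` are at distance greater than `ℓ` (infinite distance is allowed). -/
def IsPackingColoring (G : SimpleGraph V) (k : ℕ) (c : V → ℕ) : Prop :=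
  (∀ v, 1 ≤ c v ∧ c v ≤ k) ∧ ∀ u v, u ≠ v → c u = c v → (c u : ℕ∞) < G.edist u v

/-- The packing chromatic number: the least `k` such that `G` has a packing `k`-coloring
(`⊤` if there is none, which never happens for a finite graph). -/
noncomputable def packingChromaticNumber (G : SimpleGraph V) : ℕ∞ :=
  ⨅ (k : ℕ) (_ : ∃ c : V → ℕ, G.IsPackingColoring k c), (k : ℕ∞)

/-- The Sierpiński packing chromatic number of the pair `(G, H)`. -/
noncomputable def sierpinskiPackingChromaticNumber
    (G : SimpleGraph V) (H : SimpleGraph W) : ℕ∞ :=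
  ⨅ f : V → W, (G.sierpinskiProduct H f).packingChromaticNumber

/-- The upper Sierpiński packing chromatic number of the pair `(G, H)`. -/
noncomputable def upperSierpinskiPackingChromaticNumber
    (G : SimpleGraph V) (H : SimpleGraph W) : ℕ∞ :=
  ⨆ f : V → W, (G.sierpinskiProduct H f).packingChromaticNumber

end SimpleGraph

/-! The neighbors of a vertex of color 1 have different colors, none of them 1, so high-degree
vertices rarely get color 1. With two colors, every center is 2 and every leaf 1, and no connecting
edge fits. Three colors suffice when `f` alternates between the center and a leaf, using two leaves
in turn: consecutive centers are then 2 apart and take colors 2, 3 alternately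
(`isPackingColoring_alternatingMap`). For 9 colors and any `f`, one vertex per star carries a letter
of a periodic packing word over {3, …, 9}; colors 1 and 2 handle the rest
(`isPackingColoring_nineColoring`). For the lower bounds, let `f` be constantly the center. The
product is a caterpillar, and with `k ≤ n + 2` colors its interior spine avoids color 1. The spine
then spells a packing word over {2, …, k}, possibly with 1 at an end
(`isSpineWord_of_isPackingColoring`); a finite search rules this out for length 10 if `k = 5` and
length 35 if `k = 6`. -/

/-- Exhaustive search: a word of length `j` has no extension by `t` further letters from
`{2, …, 6}` for which equal letters `ℓ` are more than `ℓ` apart and the letter at position `j` is at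
most `u j`. The arguments `a₂, …, a₆` are how far back the letters `2, …, 6` last occurred. -/
def noExtension (u : ℕ → ℕ) : (t j a₂ a₃ a₄ a₅ a₆ : ℕ) → Bool
  | 0, _, _, _, _, _, _ => false
  | t + 1, j, a₂, a₃, a₄, a₅, a₆ =>
    (bif Nat.ble a₂ 2 then true else bif Nat.ble 2 (u j) then
      noExtension u t (.succ j) 1 (.succ a₃) (.succ a₄) (.succ a₅) (.succ a₆) else true) &&
    ((bif Nat.ble a₃ 3 then true else bif Nat.ble 3 (u j) then
      noExtension u t (.succ j) (.succ a₂) 1 (.succ a₄) (.succ a₅) (.succ a₆) else true) &&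
    ((bif Nat.ble a₄ 4 then true else bif Nat.ble 4 (u j) then
      noExtension u t (.succ j) (.succ a₂) (.succ a₃) 1 (.succ a₅) (.succ a₆) else true) &&
    ((bif Nat.ble a₅ 5 then true else bif Nat.ble 5 (u j) then
      noExtension u t (.succ j) (.succ a₂) (.succ a₃) (.succ a₄) 1 (.succ a₆) else true) &&
    (bif Nat.ble a₆ 6 then true else bif Nat.ble 6 (u j) then
      noExtension u t (.succ j) (.succ a₂) (.succ a₃) (.succ a₄) (.succ a₅) 1 else true))))

/-- The search can follow `s` itself down to depth `L`. A counter small enough to forbid a letter is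
always witnessed by a real earlier occurrence, so the branch of `s j` is never pruned. -/
theorem noExtension_eq_false {u s : ℕ → ℕ} {L : ℕ}
    (hs : ∀ j < L, 2 ≤ s j ∧ s j ≤ 6 ∧ s j ≤ u j)
    (hp : ∀ i j, i < j → j < L → s i = s j → s i < j - i) (t j a₂ a₃ a₄ a₅ a₆ : ℕ) (h : t + j = L)
    (h₂ : 2 < a₂ ∨ ∃ i < j, s i = 2 ∧ j ≤ i + a₂) (h₃ : 3 < a₃ ∨ ∃ i < j, s i = 3 ∧ j ≤ i + a₃)
    (h₄ : 4 < a₄ ∨ ∃ i < j, s i = 4 ∧ j ≤ i + a₄) (h₅ : 5 < a₅ ∨ ∃ i < j, s i = 5 ∧ j ≤ i + a₅)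
    (h₆ : 6 < a₆ ∨ ∃ i < j, s i = 6 ∧ j ≤ i + a₆) :
    noExtension u t j a₂ a₃ a₄ a₅ a₆ = false := by
  induction t generalizing j a₂ a₃ a₄ a₅ a₆ with
  | zero => rfl
  | succ t ih =>
    obtain ⟨h2, h6, hu⟩ := hs j (by omega)
    have old : ∀ c a, (c < a ∨ ∃ i < j, s i = c ∧ j ≤ i + a) →
        (c < a.succ ∨ ∃ i < j + 1, s i = c ∧ j + 1 ≤ i + a.succ) := by
      rintro c a (ha | ⟨i, hi, hc, hj⟩)
      · exact .inl (by omega)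
      · exact .inr ⟨i, by omega, hc, by omega⟩
    have new : ∀ c, s j = c → (c < 1 ∨ ∃ i < j + 1, s i = c ∧ j + 1 ≤ i + 1) :=
      fun c hc => .inr ⟨j, by omega, hc, le_rfl⟩
    have fresh : ∀ c a, s j = c → (c < a ∨ ∃ i < j, s i = c ∧ j ≤ i + a) →
        Nat.ble a c = false := by
      rintro c a hc ha
      rw [← Bool.not_eq_true, Nat.ble_eq]
      rcases ha with ha | ⟨i, hi, hic, hj⟩
      · omega
      · have := hp i j hi (by omega) (hic.trans hc.symm)
        omega
    have le_u : ∀ c, s j = c → Nat.ble c (u j) = true := by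
      rintro c rfl
      rwa [Nat.ble_eq]
    have o₂ := old 2 a₂ h₂
    have o₃ := old 3 a₃ h₃
    have o₄ := old 4 a₄ h₄
    have o₅ := old 5 a₅ h₅
    have o₆ := old 6 a₆ h₆
    have hj : s j = 2 ∨ s j = 3 ∨ s j = 4 ∨ s j = 5 ∨ s j = 6 := by omega
    rcases hj with e | e | e | e | e
    · simp [noExtension, fresh _ _ e h₂, le_u _ e, ih _ _ _ _ _ _ (by omega) (new _ e) o₃ o₄ o₅ o₆]
    · simp [noExtension, fresh _ _ e h₃, le_u _ e, ih _ _ _ _ _ _ (by omega) o₂ (new _ e) o₄ o₅ o₆]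
    · simp [noExtension, fresh _ _ e h₄, le_u _ e, ih _ _ _ _ _ _ (by omega) o₂ o₃ (new _ e) o₅ o₆]
    · simp [noExtension, fresh _ _ e h₅, le_u _ e, ih _ _ _ _ _ _ (by omega) o₂ o₃ o₄ (new _ e) o₆]
    · simp [noExtension, fresh _ _ e h₆, le_u _ e, ih _ _ _ _ _ _ (by omega) o₂ o₃ o₄ o₅ (new _ e)]

/-- There is no packing word of length `L` over `{2, …, 6}` with letters bounded by `u` if the
exhaustive search finds none. -/
theorem false_of_noExtension {u s : ℕ → ℕ} {L : ℕ}
    (hn : noExtension u L 0 7 7 7 7 7 = true)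
    (hs : ∀ j < L, 2 ≤ s j ∧ s j ≤ 6 ∧ s j ≤ u j)
    (hp : ∀ i j, i < j → j < L → s i = s j → s i < j - i) : False :=
  Bool.noConfusion (hn.symm.trans (noExtension_eq_false hs hp L 0 7 7 7 7 7 rfl
    (.inl (by norm_num)) (.inl (by norm_num)) (.inl (by norm_num)) (.inl (by norm_num))
    (.inl (by norm_num))))

/-! ### Words along the spine of a caterpillar -/

/-- The colors seen along the first `M` spine vertices of a caterpillar in a packing
`k`-coloring: the color `1` can only occur at the two ends, and then the pendant vertices at that
end carry the remaining colors. -/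
structure IsSpineWord (k M : ℕ) (s : ℕ → ℕ) : Prop where
  one_le : ∀ j < M, 1 ≤ s j
  le : ∀ j < M, s j ≤ k
  lt_sub : ∀ i j, i < j → j < M → s i = s j → s i < j - i
  ne_one : ∀ j, 0 < j → j + 1 < M → s j ≠ 1
  le_of_left : s 0 = 1 → ∀ j, 2 ≤ j → j + 1 < M → s j ≤ j
  le_of_right : s (M - 1) = 1 → ∀ j, 1 ≤ j → j + 2 < M → s j ≤ M - 1 - j

theorem IsSpineWord.reverse {k M : ℕ} {s : ℕ → ℕ} (h : IsSpineWord k M s) :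
    IsSpineWord k M fun j => s (M - 1 - j) where
  one_le j hj := h.one_le _ (by omega)
  le j hj := h.le _ (by omega)
  lt_sub i j hij hj e := by
    have := h.lt_sub (M - 1 - j) (M - 1 - i) (by omega) (by omega) e.symm
    have e' : s (M - 1 - i) = s (M - 1 - j) := e
    change s (M - 1 - i) < j - i
    omega
  ne_one j h0 hj := h.ne_one _ (by omega) (by omega)
  le_of_left h1 j h2 hj := by
    have := h.le_of_right h1 (M - 1 - j) (by omega) (by omega)
    omega
  le_of_right h1 j h2 hj := by
    simp only [Nat.sub_self] at h1
    exact h.le_of_left h1 (M - 1 - j) (by omega) (by omega)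

theorem IsSpineWord.two_le {k M : ℕ} {s : ℕ → ℕ} (h : IsSpineWord k M s) {j : ℕ} (hj : j < M)
    (h1 : s j ≠ 1) : 2 ≤ s j := by
  have := h.one_le j hj
  omega

theorem IsSpineWord.two_le_tail {k M : ℕ} {s : ℕ → ℕ} (h : IsSpineWord k M s) {j : ℕ}
    (hj : j + 2 < M) : 2 ≤ s (j + 1) :=
  h.two_le (by omega) (h.ne_one _ (by omega) (by omega))

theorem IsSpineWord.lt_sub_tail {k M : ℕ} {s : ℕ → ℕ} (h : IsSpineWord k M s) {i j : ℕ}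
    (hij : i < j) (hj : j + 1 < M) (e : s (i + 1) = s (j + 1)) : s (i + 1) < j - i := by
  have := h.lt_sub (i + 1) (j + 1) (by omega) (by omega) e
  omega

/-- Index `j` stands for spine position `j + 1`. Position 1 escapes the bound: it may itself be the
neighbor of the end that carries its color. -/
theorem noExtension_five_left : noExtension
    (fun j => bif Nat.beq j 0 then 5 else min 5 (j + 1)) 8 0 7 7 7 7 7 = true := by
  decide +kernel

theorem noExtension_five : noExtension (fun _ => 5) 9 0 7 7 7 7 7 = true := by
  decide +kernel

/-- Both ends have color 1, so the bound is the distance to the nearer end, except next to the ends.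
-/
theorem noExtension_six_left_right : noExtension
    (fun j => bif Nat.beq j 0 || Nat.beq j 32 then 6 else min (j + 1) (33 - j))
    33 0 7 7 7 7 7 = true := by
  decide +kernel

theorem noExtension_six_left : noExtension
    (fun j => bif Nat.beq j 0 || Nat.beq j 33 then 6 else j + 1) 34 0 7 7 7 7 7 = true := by
  decide +kernel

theorem noExtension_six : noExtension (fun _ => 6) 35 0 7 7 7 7 7 = true := by
  decide +kernel

theorem not_isSpineWord_five (s : ℕ → ℕ) : ¬ IsSpineWord 5 10 s := by
  intro h
  by_cases h0 : s 0 = 1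
  · refine false_of_noExtension noExtension_five_left (s := fun j => s (j + 1)) (fun j hj => ?_)
      fun i j hij hj => h.lt_sub_tail hij (by omega)
    have h5 := h.le (j + 1) (by omega)
    refine ⟨h.two_le_tail (by omega), by omega, ?_⟩
    rcases j with _ | j
    · exact h5
    · exact le_min h5 (h.le_of_left h0 _ (by omega) (by omega))
  -- Nine letters only: the tenth may be 1.
  · refine false_of_noExtension noExtension_five (s := s) (fun j hj => ?_)
      fun i j hij hj => h.lt_sub i j hij (by omega)
    have h5 := h.le j (by omega)
    refine ⟨h.two_le (by omega) ?_, by omega, h5⟩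
    rcases j with _ | j
    · exact h0
    · exact h.ne_one _ (by omega) (by omega)

theorem IsSpineWord.left_ne_one {s : ℕ → ℕ} (h : IsSpineWord 6 35 s) : s 0 ≠ 1 := by
  intro h0
  have beq_false : ∀ {a b : ℕ}, a ≠ b → Nat.beq a b = false := fun hab => by
    rw [← Bool.not_eq_true, Nat.beq_eq]
    exact hab
  by_cases h34 : s 34 = 1
  · refine false_of_noExtension noExtension_six_left_right (s := fun j => s (j + 1))
      (fun j hj => ?_) fun i j hij hj => h.lt_sub_tail hij (by omega)
    have h6 := h.le (j + 1) (by omega)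
    refine ⟨h.two_le_tail (by omega), h6, ?_⟩
    rcases eq_or_ne j 0 with rfl | hj0
    · exact h6
    rcases eq_or_ne j 32 with rfl | hj1
    · exact h6
    have h2 := h.le_of_left h0 (j + 1) (by omega) (by omega)
    have h3 := h.le_of_right h34 (j + 1) (by omega) (by omega)
    simp only [beq_false hj0, beq_false hj1, Bool.or_false, cond_false]
    omega
  · refine false_of_noExtension noExtension_six_left (s := fun j => s (j + 1))
      (fun j hj => ?_) fun i j hij hj => h.lt_sub_tail hij (by omega)
    have h6 := h.le (j + 1) (by omega)
    rcases eq_or_ne j 33 with rfl | hj1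
    · exact ⟨h.two_le (by omega) h34, h6, h6⟩
    refine ⟨h.two_le_tail (by omega), h6, ?_⟩
    rcases eq_or_ne j 0 with rfl | hj0
    · exact h6
    have h2 := h.le_of_left h0 (j + 1) (by omega) (by omega)
    simpa only [beq_false hj0, beq_false hj1, Bool.or_false, cond_false] using h2

theorem not_isSpineWord_six (s : ℕ → ℕ) : ¬ IsSpineWord 6 35 s := by
  intro h
  refine false_of_noExtension noExtension_six (s := s) (fun j hj => ?_) h.lt_sub
  refine ⟨h.two_le hj ?_, h.le j hj, h.le j hj⟩
  rcases eq_or_ne j 0 with rfl | hj0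
  · exact h.left_ne_one
  rcases eq_or_ne j 34 with rfl | hj1
  · exact h.reverse.left_ne_one
  · exact h.ne_one _ (by omega) (by omega)

/-! ### Distances and packing colorings in general graphs -/

namespace SimpleGraph

variable {V : Type*} {G : SimpleGraph V}

/-- Each edge changes `φ` by at most 1. This replaces the computation of geodesics when distances
must be bounded below. -/
theorem natAbs_sub_le_edist (φ : V → ℤ) (hφ : ∀ u v, G.Adj u v → (φ u - φ v).natAbs ≤ 1) (u v : V) :
    ((φ u - φ v).natAbs : ℕ∞) ≤ G.edist u v := by
  by_cases h : G.edist u v = ⊤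
  · simp [h]
  obtain ⟨p, hp⟩ := exists_walk_of_edist_ne_top h
  rw [← hp, Nat.cast_le]
  clear hp h
  induction p with
  | nil => simp
  | cons hadj p ih =>
    have := hφ _ _ hadj
    rw [Walk.length_cons]
    omega

theorem IsPackingColoring.mono {k l : ℕ} {c : V → ℕ} (h : G.IsPackingColoring k c) (hkl : k ≤ l) :
    G.IsPackingColoring l c :=
  ⟨fun v => ⟨(h.1 v).1, (h.1 v).2.trans hkl⟩, h.2⟩

theorem IsPackingColoring.packingChromaticNumber_le {k : ℕ} {c : V → ℕ}
    (h : G.IsPackingColoring k c) : G.packingChromaticNumber ≤ k :=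
  iInf₂_le k ⟨c, h⟩

theorem succ_le_packingChromaticNumber {k : ℕ} (h : ∀ c, ¬ G.IsPackingColoring k c) :
    ((k + 1 : ℕ) : ℕ∞) ≤ G.packingChromaticNumber := by
  refine le_iInf₂ fun l ⟨c, hc⟩ => ?_
  rw [Nat.cast_le]
  by_contra hlt
  exact h c (hc.mono (by omega))

theorem IsPackingColoring.lt_of_edist_le {k d : ℕ} {c : V → ℕ} (h : G.IsPackingColoring k c)
    {u v : V} (hne : u ≠ v) (hd : G.edist u v ≤ d) (hc : c u = c v) : c u < d :=
  Nat.cast_lt.1 ((h.2 u v hne hc).trans_le hd)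

theorem IsPackingColoring.ne_of_adj {k : ℕ} {c : V → ℕ} (h : G.IsPackingColoring k c) {u v : V}
    (hadj : G.Adj u v) : c u ≠ c v := by
  intro hc
  have := h.lt_of_edist_le (d := 1) hadj.ne (by simp [edist_eq_one_iff_adj.2 hadj]) hc
  have := (h.1 u).1
  omega

theorem edist_le_two_of_adj_of_adj {u v w : V} (h₁ : G.Adj u v) (h₂ : G.Adj v w) :
    G.edist u w ≤ (2 : ℕ) :=
  (Walk.cons h₁ (.cons h₂ .nil)).edist_le

/-- The colors of the neighbors of a vertex of color `1` are different elements of `{2, …, k}`. -/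
theorem IsPackingColoring.neighbors {k : ℕ} {c : V → ℕ} (h : G.IsPackingColoring k c) {v : V}
    (hv : c v = 1) (N : Finset V) (hN : ∀ w ∈ N, G.Adj v w) :
    N.image c ⊆ Finset.Icc 2 k ∧ (N.image c).card = N.card := by
  have hc : ∀ w ∈ N, 2 ≤ c w ∧ c w ≤ k := fun w hw => by
    have := h.1 w
    have := h.ne_of_adj (hN w hw)
    omega
  refine ⟨fun x hx => ?_, Finset.card_image_of_injOn fun w hw w' hw' e => ?_⟩
  · obtain ⟨w, hw, rfl⟩ := Finset.mem_image.1 hx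
    exact Finset.mem_Icc.2 (hc w hw)
  · by_contra hne
    have := h.lt_of_edist_le hne
      (edist_le_two_of_adj_of_adj (hN w hw).symm (hN w' hw')) e
    have := hc w hw
    omega

theorem IsPackingColoring.card_neighbors_lt {k : ℕ} {c : V → ℕ} (h : G.IsPackingColoring k c)
    {v : V} (hv : c v = 1) (N : Finset V) (hN : ∀ w ∈ N, G.Adj v w) : N.card < k := by
  obtain ⟨h₁, h₂⟩ := h.neighbors hv N hN
  have h₃ := Finset.card_le_card h₁
  have h₄ := (h.1 v)
  rw [Nat.card_Icc, h₂] at h₃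
  omega

theorem IsPackingColoring.exists_neighbor {k : ℕ} {c : V → ℕ} (h : G.IsPackingColoring k c)
    {v : V} (hv : c v = 1) (N : Finset V) (hN : ∀ w ∈ N, G.Adj v w) (hk : k ≤ N.card + 1) {y : ℕ}
    (hy : 2 ≤ y) (hyk : y ≤ k) : ∃ w ∈ N, c w = y := by
  obtain ⟨h₁, h₂⟩ := h.neighbors hv N hN
  have := Finset.eq_of_subset_of_card_le h₁ (by rw [Nat.card_Icc, h₂]; omega)
  exact Finset.mem_image.1 (this ▸ Finset.mem_Icc.2 ⟨hy, hyk⟩)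

/-! ### The product of a path and a star -/

/-- The Sierpiński product of the path on `m` vertices and the star with `n` leaves. -/
abbrev pathStar {m n : ℕ} (f : Fin m → Fin 1 ⊕ Fin n) : SimpleGraph (Fin m × (Fin 1 ⊕ Fin n)) :=
  (pathGraph m).sierpinskiProduct (completeBipartiteGraph (Fin 1) (Fin n)) f

variable {m n : ℕ} {f : Fin m → Fin 1 ⊕ Fin n}

theorem pathStar_adj {i j : Fin m} {x y : Fin 1 ⊕ Fin n} : (pathStar f).Adj (i, x) (j, y) ↔
    (i = j ∧ (x.isLeft ∧ y.isRight ∨ x.isRight ∧ y.isLeft)) ∨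
      (((i : ℕ) + 1 = j ∨ (j : ℕ) + 1 = i) ∧ x = f j ∧ y = f i) := by
  rw [← pathGraph_adj]
  rfl

theorem pathStar_adj_leaf (i : Fin m) (a : Fin n) :
    (pathStar f).Adj (i, .inl 0) (i, .inr a) :=
  pathStar_adj.2 (.inl ⟨rfl, by simp⟩)

theorem pathStar_adj_succ {i j : Fin m} (h : (i : ℕ) + 1 = j) :
    (pathStar f).Adj (i, f j) (j, f i) :=
  pathStar_adj.2 (.inr ⟨.inl h, rfl, rfl⟩)

theorem eq_inl_zero_of_isLeft {x : Fin 1 ⊕ Fin n} (h : x.isLeft = true) : x = .inl 0 := by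
  rcases x with x | x
  · rw [Subsingleton.elim x 0]
  · simp at h

/-! ### The lower bound `3` -/

theorem not_isPackingColoring_two (hm : 2 ≤ m) (hn : 3 ≤ n) (f : Fin m → Fin 1 ⊕ Fin n)
    (c : Fin m × (Fin 1 ⊕ Fin n) → ℕ) : ¬ (pathStar f).IsPackingColoring 2 c := by
  intro h
  have center : ∀ i, c (i, .inl 0) = 2 := fun i => by
    have h1 : c (i, .inl 0) ≠ 1 := fun h1 => by
      have := h.card_neighbors_lt h1 (Finset.univ.image fun a : Fin n => (i, .inr a)) (by
        simp only [Finset.mem_image, Finset.mem_univ, true_and]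
        rintro w ⟨a, rfl⟩
        exact pathStar_adj_leaf i a)
      rw [Finset.card_image_of_injective _ fun a b hab => by simpa using hab, Finset.card_fin]
        at this
      omega
    have := h.1 (i, .inl 0)
    omega
  have leaf : ∀ i a, c (i, .inr a) = 1 := fun i a => by
    have := h.1 (i, .inr a)
    have := h.ne_of_adj (pathStar_adj_leaf (f := f) i a)
    have := center i
    omega
  have hadj := pathStar_adj_succ (f := f) (i := ⟨0, by omega⟩) (j := ⟨1, by omega⟩) rfl
  have hne := h.ne_of_adj hadj
  -- An edge from a center to a leaf of another star puts two centers, both of color 2, at distance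
  -- at most 2.
  have far : ∀ {i j : Fin m} {x : Fin 1 ⊕ Fin n}, i ≠ j →
      (pathStar f).Adj (i, .inl 0) (j, x) → x.isRight → False := by
    intro i j x hij hx hr
    obtain ⟨a, rfl⟩ := Sum.isRight_iff.1 hr
    have := h.lt_of_edist_le (by simpa using hij)
      (edist_le_two_of_adj_of_adj hx (pathStar_adj_leaf j a).symm) (by simp [center])
    simp [center] at this
  rcases h1 : f ⟨1, by omega⟩ with x | a <;> rcases h0 : f ⟨0, by omega⟩ with y | b
  · rw [h0, h1, Subsingleton.elim x 0, Subsingleton.elim y 0, center, center] at hne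
    exact hne rfl
  · rw [h0, h1, Subsingleton.elim x 0] at hadj
    exact far (by simp) hadj rfl
  · rw [h0, h1, Subsingleton.elim y 0] at hadj
    exact far (by simp) hadj.symm rfl
  · rw [h0, h1, leaf, leaf] at hne
    exact hne rfl

/-! ### A product with packing chromatic number `3` -/

/-- The map `0, 1, 0, 2, 0, 1, 0, 2, …`, where `0` stands for the center of the star. -/
def alternatingMap (m n : ℕ) (hn : 3 ≤ n) (i : Fin m) : Fin 1 ⊕ Fin n :=
  if (i : ℕ) % 4 = 1 then .inr ⟨0, by omega⟩
  else if (i : ℕ) % 4 = 3 then .inr ⟨1, by omega⟩ else .inl 0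

/-- A `1`-Lipschitz function on the product for `alternatingMap`, along which consecutive centers
are `2` apart. -/
def alternatingHeight : Fin m × (Fin 1 ⊕ Fin n) → ℤ
  | (i, .inl _) => 2 * i
  | (i, .inr a) =>
    if ((i : ℕ) % 4 = 0 ∧ (a : ℕ) = 0) ∨ ((i : ℕ) % 4 = 2 ∧ (a : ℕ) = 1) then 2 * i + 1
    else if ((i : ℕ) % 4 = 0 ∧ (a : ℕ) = 1) ∨ ((i : ℕ) % 4 = 2 ∧ (a : ℕ) = 0) then 2 * i - 1
    else 2 * i

theorem alternatingHeight_sub_inl (i : Fin m) (x y : Fin 1 ⊕ Fin n) (hx : x.isLeft) :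
    (alternatingHeight (i, x) - alternatingHeight (i, y)).natAbs ≤ 1 := by
  rw [eq_inl_zero_of_isLeft hx]
  rcases y with y | a
  · simp [alternatingHeight]
  · simp only [alternatingHeight]
    split_ifs <;> omega

theorem alternatingHeight_succ (hn : 3 ≤ n) {i j : Fin m} (h : (i : ℕ) + 1 = j) :
    (alternatingHeight (i, alternatingMap m n hn j) -
      alternatingHeight (j, alternatingMap m n hn i)).natAbs ≤ 1 := by
  have hj : (j : ℤ) = i + 1 := by omega
  have : (i : ℕ) % 4 < 4 := Nat.mod_lt _ (by norm_num)
  have : (j : ℕ) % 4 = (i + 1) % 4 := by rw [h]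
  interval_cases hi : (i : ℕ) % 4
  all_goals
    have hj4 : (j : ℕ) % 4 = 0 ∨ (j : ℕ) % 4 = 1 ∨ (j : ℕ) % 4 = 2 ∨ (j : ℕ) % 4 = 3 := by omega
    rcases hj4 with hj4 | hj4 | hj4 | hj4 <;> try omega
    simp [alternatingMap, alternatingHeight, hi, hj4]
    omega

theorem natAbs_alternatingHeight_le (hn : 3 ≤ n) (u v : Fin m × (Fin 1 ⊕ Fin n))
    (h : (pathStar (alternatingMap m n hn)).Adj u v) :
    (alternatingHeight u - alternatingHeight v).natAbs ≤ 1 := by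
  obtain ⟨i, x⟩ := u
  obtain ⟨j, y⟩ := v
  rcases pathStar_adj.1 h with ⟨rfl, h | h⟩ | ⟨hij | hij, rfl, rfl⟩
  · exact alternatingHeight_sub_inl i x y h.1
  · rw [← Int.natAbs_neg, neg_sub]
    exact alternatingHeight_sub_inl i y x h.2
  · exact alternatingHeight_succ hn hij
  · rw [← Int.natAbs_neg, neg_sub]
    exact alternatingHeight_succ hn hij

/-- Centers of equal color have indices of equal parity, hence heights at least 4 apart. Leaves are
never adjacent, since one of two consecutive values of the map is the center. -/
theorem isPackingColoring_alternatingMap (hn : 3 ≤ n) :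
    (pathStar (alternatingMap m n hn)).IsPackingColoring 3
      fun v => if v.2.isLeft then 2 + (v.1 : ℕ) % 2 else 1 := by
  refine ⟨fun v => by dsimp only; split_ifs <;> omega, ?_⟩
  rintro ⟨i, x⟩ ⟨j, y⟩ hne hc
  dsimp only at hc ⊢
  split_ifs at hc ⊢ with hx hy hy
  · rw [eq_inl_zero_of_isLeft hx, eq_inl_zero_of_isLeft hy] at hne ⊢
    have hij : (i : ℕ) ≠ j := fun e => hne (by rw [Fin.ext e])
    refine lt_of_lt_of_le ?_
      (natAbs_sub_le_edist alternatingHeight (natAbs_alternatingHeight_le hn) _ _)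
    rw [Nat.cast_lt]
    simp only [alternatingHeight]
    omega
  · omega
  · omega
  · rw [Nat.cast_one, ← not_le, edist_le_one_iff_adj_or_eq]
    rintro (h | h)
    · rcases pathStar_adj.1 h with ⟨-, h | h⟩ | ⟨h, rfl, rfl⟩
      · exact hx h.1
      · exact hy h.2
      · simp only [alternatingMap] at hx hy
        split_ifs at hx hy <;> first | omega | simp at hx hy
    · exact hne h

/-! ### The upper bound `9` -/

/-- A periodic word over `{3, …, 9}` in which equal letters `ℓ` are more than `ℓ` apart. -/
def packingWord (i : ℕ) : ℕ :=
  [3, 4, 5, 7, 3, 6, 4, 8, 3, 5, 9, 4, 6, 3, 7, 5, 4, 3, 8, 6, 9].getD (i % 21) 3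

theorem packingWord_mem (i : ℕ) : 3 ≤ packingWord i ∧ packingWord i ≤ 9 := by
  have : ∀ r < 21, 3 ≤ packingWord r ∧ packingWord r ≤ 9 := by decide
  simpa [packingWord] using this (i % 21) (Nat.mod_lt _ (by norm_num))

theorem packingWord_lt_sub {i j : ℕ} (hij : i < j) (h : packingWord i = packingWord j) :
    packingWord i < j - i := by
  -- Letters are at most 9, so a violation has a gap below 10; periodicity reduces the start to one
  -- period.
  have key : ∀ r < 21, ∀ d < 10, 0 < d → packingWord r = packingWord (r + d) →
      packingWord r < d := by decide
  by_contra hlt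
  have h9 := (packingWord_mem i).2
  have e : packingWord (i % 21) = packingWord i := by simp [packingWord]
  have e' : packingWord (i % 21 + (j - i)) = packingWord j := by
    simp only [packingWord]
    congr 1
    omega
  exact hlt (e ▸ key (i % 21) (Nat.mod_lt _ (by norm_num)) (j - i) (by omega) (by omega)
    (by rw [e, e', h]))

theorem natAbs_sub_fst_le_edist (u v : Fin m × (Fin 1 ⊕ Fin n)) :
    (((u.1 : ℤ) - (v.1 : ℤ)).natAbs : ℕ∞) ≤ (pathStar f).edist u v := by
  refine natAbs_sub_le_edist (fun u => ((u.1 : ℕ) : ℤ)) (fun u v h => ?_) u v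
  obtain ⟨i, x⟩ := u
  obtain ⟨j, y⟩ := v
  rcases pathStar_adj.1 h with ⟨rfl, -⟩ | ⟨h, -⟩
  · simp
  · dsimp only
    omega

/-- Extension of `f` by the center of the star. -/
def extendMap (f : Fin m → Fin 1 ⊕ Fin n) (i : ℕ) : Fin 1 ⊕ Fin n :=
  if h : i < m then f ⟨i, h⟩ else .inl 0

theorem extendMap_val (i : Fin m) : extendMap f i = f i := by
  simp [extendMap]

/-- The connecting edge that enters the `i`-th star joins two leaves. -/
def EntersAtLeaf (f : Fin m → Fin 1 ⊕ Fin n) (i : ℕ) : Prop :=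
  -- The guard excludes the first star, where `i - 1` truncates to 0.
  1 ≤ i ∧ (extendMap f (i - 1)).isRight ∧ (extendMap f i).isRight

open Classical in
/-- The packing `9`-coloring: exactly one vertex of the `i`-th star gets the color `packingWord i`,
namely the center, unless the star is entered by an edge joining two leaves. -/
noncomputable def nineColoring (f : Fin m → Fin 1 ⊕ Fin n) (v : Fin m × (Fin 1 ⊕ Fin n)) : ℕ :=
  if EntersAtLeaf f v.1 then
    if v.2.isLeft then 2 else if v.2 = extendMap f (v.1 - 1) then packingWord v.1 else 1
  else if v.2.isLeft then packingWord v.1 else 1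

theorem nineColoring_cases (i : Fin m) (x : Fin 1 ⊕ Fin n) :
    (nineColoring f (i, x) = 1 ∧ x.isRight ∧
        (EntersAtLeaf f i → x ≠ extendMap f (i - 1))) ∨
      (nineColoring f (i, x) = 2 ∧ EntersAtLeaf f i ∧ x = .inl 0) ∨
      (nineColoring f (i, x) = packingWord i ∧
        ((EntersAtLeaf f i ∧ x = extendMap f (i - 1)) ∨ (¬ EntersAtLeaf f i ∧ x = .inl 0))) := by
  unfold nineColoring
  dsimp only
  split_ifs with h1 h2 h3 h4
  · exact .inr (.inl ⟨rfl, h1, eq_inl_zero_of_isLeft h2⟩)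
  · exact .inr (.inr ⟨rfl, .inl ⟨h1, h3⟩⟩)
  · exact .inl ⟨rfl, by simpa using h2, fun _ => h3⟩
  · exact .inr (.inr ⟨rfl, .inr ⟨h1, eq_inl_zero_of_isLeft h4⟩⟩)
  · exact .inl ⟨rfl, by simpa using h4, fun h => absurd h h1⟩

/-- A leaf value of `f` at `i - 1` bars the center from a backward edge; a forward edge forces `f`
to be the center at `i + 1`, so that the next star is not entered leaf to leaf. This keeps centers
of color 2 more than 2 apart. -/
theorem EntersAtLeaf.fst_of_adj {i : Fin m} (hi : EntersAtLeaf f i)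
    {w : Fin m × (Fin 1 ⊕ Fin n)} (h : (pathStar f).Adj (i, .inl 0) w) :
    (w.1 : ℕ) = i ∨ ((w.1 : ℕ) = i + 1 ∧ ¬ EntersAtLeaf f w.1) := by
  obtain ⟨j, y⟩ := w
  rcases pathStar_adj.1 h with ⟨rfl, -⟩ | ⟨h | h, hx, -⟩
  · exact .inl rfl
  · refine .inr ⟨h.symm, fun hj => ?_⟩
    have := hj.2.2
    rw [extendMap_val, ← hx] at this
    simp at this
  · have := hi.2.1
    have e : (i : ℕ) - 1 = j := by omega
    rw [e, extendMap_val, ← hx] at this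
    simp at this

theorem isPackingColoring_nineColoring (f : Fin m → Fin 1 ⊕ Fin n) :
    (pathStar f).IsPackingColoring 9 (nineColoring f) := by
  constructor
  · rintro ⟨i, x⟩
    have := packingWord_mem i
    rcases nineColoring_cases (f := f) i x with h | h | h <;> omega
  rintro ⟨i, x⟩ ⟨j, y⟩ hne hc
  have hi := packingWord_mem i
  have hj := packingWord_mem j
  rcases nineColoring_cases (f := f) i x with ⟨h1, h2, h3⟩ | ⟨h1, h2, h3⟩ | ⟨h1, h2⟩ <;>
  rcases nineColoring_cases (f := f) j y with ⟨h1', h2', h3'⟩ | ⟨h1', h2', h3'⟩ | ⟨h1', h2'⟩ <;>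
  try omega
  · rw [h1, Nat.cast_one, ← not_le, edist_le_one_iff_adj_or_eq]
    rintro (h | h)
    · rcases pathStar_adj.1 h with ⟨-, ⟨h, -⟩ | ⟨-, h⟩⟩ | ⟨h | h, rfl, rfl⟩
      · rw [eq_inl_zero_of_isLeft h] at h2
        simp at h2
      · rw [eq_inl_zero_of_isLeft h] at h2'
        simp at h2'
      · have e : (j : ℕ) - 1 = i := by omega
        rw [e, extendMap_val] at h3'
        refine h3' ⟨by omega, ?_, ?_⟩ rfl
        · rwa [e, extendMap_val]
        · rwa [extendMap_val]
      · have e : (i : ℕ) - 1 = j := by omega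
        rw [e, extendMap_val] at h3
        refine h3 ⟨by omega, ?_, ?_⟩ rfl
        · rwa [e, extendMap_val]
        · rwa [extendMap_val]
    · exact hne h
  · subst h3 h3'
    have hij : (i : ℕ) ≠ j := fun e => hne (by rw [Fin.ext e])
    rw [h1, Nat.cast_ofNat, two_lt_edist_iff]
    refine ⟨hne, fun h => ?_, Set.eq_empty_iff_forall_notMem.2 fun w hw => ?_⟩
    · rcases h2.fst_of_adj h with e | e
      · exact hij e.symm
      · exact e.2 h2'
    · rw [mem_commonNeighbors] at hw
      rcases h2.fst_of_adj hw.1 with e | e <;> rcases h2'.fst_of_adj hw.2 with e' | e'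
      · omega
      · exact e'.2 (e ▸ h2)
      · exact e.2 (e' ▸ h2')
      · omega
  -- Each star has a single vertex carrying its word letter.
  · have hij : (i : ℕ) ≠ j := by
      intro e
      obtain rfl := Fin.ext e
      refine hne (congrArg _ ?_)
      rcases h2 with h2 | h2 <;> rcases h2' with h2' | h2'
      · rw [h2.2, h2'.2]
      · exact absurd h2.1 h2'.1
      · exact absurd h2'.1 h2.1
      · rw [h2.2, h2'.2]
    refine lt_of_lt_of_le ?_ (natAbs_sub_fst_le_edist _ _)
    rw [Nat.cast_lt, h1]
    rw [h1, h1'] at hc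
    dsimp only
    rcases lt_or_gt_of_ne hij with h | h
    · have := packingWord_lt_sub h hc
      omega
    · have := packingWord_lt_sub h hc.symm
      omega

/-! ### The product for the constant map to the center -/

theorem edist_center_le {i j : Fin m} (hij : i ≤ j) :
    (pathStar fun _ : Fin m => (.inl 0 : Fin 1 ⊕ Fin n)).edist (i, .inl 0) (j, .inl 0)
      ≤ ((j - i : ℕ) : ℕ∞) := by
  obtain ⟨d, hd⟩ : ∃ d : ℕ, (j : ℕ) = i + d := ⟨j - i, by have : (i : ℕ) ≤ j := hij; omega⟩
  induction d generalizing j with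
  | zero =>
    obtain rfl : i = j := Fin.ext hd.symm
    simp
  | succ d ih =>
    have hlt : (i : ℕ) + d < m := by omega
    refine (SimpleGraph.edist_triangle (v := (⟨i + d, hlt⟩, .inl 0))).trans ?_
    have h1 := ih (j := ⟨i + d, hlt⟩) (by simp [Fin.le_def]) rfl
    have h2 := edist_eq_one_iff_adj.2 (pathStar_adj_succ
      (f := fun _ : Fin m => (.inl 0 : Fin 1 ⊕ Fin n)) (i := ⟨i + d, hlt⟩) (j := j)
      (by simp [hd, add_assoc]))
    rw [h2]
    refine (add_le_add_left h1 1).trans ?_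
    norm_cast
    simp only
    omega

theorem edist_leaf_le {i j : Fin m} (a : Fin n) {d : ℕ}
    (h : (j : ℕ) ≤ i + d) (h' : (i : ℕ) ≤ j + d) :
    (pathStar fun _ : Fin m => (.inl 0 : Fin 1 ⊕ Fin n)).edist (i, .inr a) (j, .inl 0)
      ≤ ((d + 1 : ℕ) : ℕ∞) := by
  refine (SimpleGraph.edist_triangle (v := (i, .inl 0))).trans ?_
  rw [edist_eq_one_iff_adj.2 (pathStar_adj_leaf i a).symm, add_comm, Nat.cast_add, Nat.cast_one]
  refine add_le_add_left ?_ 1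
  rcases le_total i j with hij | hij
  · refine (edist_center_le hij).trans (Nat.cast_le.2 (by omega))
  · rw [SimpleGraph.edist_comm]
    refine (edist_center_le hij).trans (Nat.cast_le.2 (by omega))

/-- An interior spine vertex has `n + 2` neighbors, too many for the `k - 1` colors other than 1. An
end has `n + 1`, so color 1 there forces its neighbors to exhaust {2, …, k}. -/
theorem isSpineWord_of_isPackingColoring {k M : ℕ} {c : Fin m × (Fin 1 ⊕ Fin n) → ℕ}
    (h : (pathStar fun _ : Fin m => (.inl 0 : Fin 1 ⊕ Fin n)).IsPackingColoring k c)
    (hM : M ≤ m) (hM2 : 2 ≤ M) (hk : k ≤ n + 2) :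
    IsSpineWord k M fun j => if hj : j < m then c (⟨j, hj⟩, .inl 0) else 0 := by
  have spine : ∀ {i j : ℕ} (hi : i < m) (hj : j < m), i < j →
      c (⟨i, hi⟩, .inl 0) = c (⟨j, hj⟩, .inl 0) → c (⟨i, hi⟩, .inl 0) < j - i :=
    fun hi hj hij e => h.lt_of_edist_le (by simp [hij.ne])
      (edist_center_le (i := ⟨_, hi⟩) (j := ⟨_, hj⟩) hij.le) e
  let N (i : Fin m) (j : Fin m) : Finset (Fin m × (Fin 1 ⊕ Fin n)) :=
    insert (j, .inl 0) (Finset.univ.image fun a : Fin n => (i, .inr a))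
  have card_N : ∀ i j, (N i j).card = n + 1 := fun i j => by
    rw [Finset.card_insert_of_notMem (by simp),
      Finset.card_image_of_injective _ fun a b hab => by simpa using hab, Finset.card_fin]
  have adj_N : ∀ i j : Fin m, ((i : ℕ) + 1 = j ∨ (j : ℕ) + 1 = i) → ∀ w ∈ N i j,
      (pathStar fun _ : Fin m => (.inl 0 : Fin 1 ⊕ Fin n)).Adj (i, .inl 0) w := by
    intro i j hij w hw
    simp only [N, Finset.mem_insert, Finset.mem_image, Finset.mem_univ, true_and] at hw
    rcases hw with rfl | ⟨a, rfl⟩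
    · exact pathStar_adj.2 (.inr ⟨hij, rfl, rfl⟩)
    · exact pathStar_adj_leaf i a
  have inner : ∀ {j : ℕ} (hj : j < m), 0 < j → j + 1 < m → c (⟨j, hj⟩, .inl 0) ≠ 1 := by
    intro j hj h0 hlt h1
    have := h.card_neighbors_lt h1
      (insert (⟨j - 1, by omega⟩, .inl 0) (N ⟨j, hj⟩ ⟨j + 1, hlt⟩)) (by
        intro w hw
        rcases Finset.mem_insert.1 hw with rfl | hw
        · exact pathStar_adj.2 (.inr ⟨.inr (show j - 1 + 1 = j by omega), rfl, rfl⟩)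
        · exact adj_N _ _ (.inl rfl) w hw)
    rw [Finset.card_insert_of_notMem (by simp [N]), card_N] at this
    omega
  -- The color of spine vertex `j` recurs next to the end `i`: on a pendant vertex, within `d + 1`
  -- of `j`, or on the spine neighbor `i'`.
  have outer : ∀ {i i' j d : ℕ} (hi : i < m) (hi' : i' < m) (hj : j < m),
      (i + 1 = i' ∨ i' + 1 = i) → c (⟨i, hi⟩, .inl 0) = 1 → 2 ≤ c (⟨j, hj⟩, .inl 0) → (j ≤ i + d) → (i ≤ j + d) →
      c (⟨j, hj⟩, .inl 0) ≤ d ∨ c (⟨i', hi'⟩, .inl 0) = c (⟨j, hj⟩, .inl 0) := by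
    intro i i' j d hi hi' hj hii h1 h2 hd hd'
    obtain ⟨w, hw, e⟩ := h.exists_neighbor h1 (N ⟨i, hi⟩ ⟨i', hi'⟩) (adj_N _ _ hii)
      (by rw [card_N]; omega) h2 (h.1 _).2
    simp only [N, Finset.mem_insert, Finset.mem_image, Finset.mem_univ, true_and] at hw
    rcases hw with rfl | ⟨a, rfl⟩
    · exact .inr e
    · have := h.lt_of_edist_le (by simp) (edist_leaf_le (i := ⟨i, hi⟩) (j := ⟨j, hj⟩) a hd hd') e
      exact .inl (by omega)
  constructor
  · intro j hj
    simpa [hj.trans_le hM] using (h.1 _).1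
  · intro j hj
    simpa [hj.trans_le hM] using (h.1 _).2
  · intro i j hij hj
    simpa [hj.trans_le hM, (hij.trans hj).trans_le hM] using spine _ _ hij
  · intro j h0 hj
    simpa [show j < m by omega] using inner (by omega) h0 (by omega)
  · intro h1 j h2 hj
    simp only [show 0 < m by omega, show j < m by omega, dif_pos] at h1 ⊢
    have := inner (j := j) (by omega) (by omega) (by omega)
    have := (h.1 (⟨j, by omega⟩, .inl 0)).1
    rcases outer (i := 0) (i' := 1) (j := j) (d := j) (by omega) (by omega) (by omega) (.inl rfl) h1
      (by omega) (by omega) (by omega) with e | e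
    · exact e
    · have := spine _ _ (by omega) e
      omega
  · intro h1 j h2 hj
    simp only [show M - 1 < m by omega, show j < m by omega, dif_pos] at h1 ⊢
    have := inner (j := j) (by omega) (by omega) (by omega)
    have := (h.1 (⟨j, by omega⟩, .inl 0)).1
    rcases outer (i := M - 1) (i' := M - 2) (j := j) (d := M - 1 - j) (by omega) (by omega)
      (by omega) (.inr (by omega)) h1 (by omega) (by omega) (by omega) with e | e
    · exact e
    · have := spine _ _ (by omega) e.symm
      omega

end SimpleGraph

open SimpleGraph

theorem theorem4p6 (m n : ℕ) (hm : 2 ≤ m) (hn : 3 ≤ n) :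
    (SimpleGraph.pathGraph m).sierpinskiPackingChromaticNumber
        (completeBipartiteGraph (Fin 1) (Fin n)) = 3 ∧
    (SimpleGraph.pathGraph m).upperSierpinskiPackingChromaticNumber
        (completeBipartiteGraph (Fin 1) (Fin n)) ≤ 9 ∧
    (n = 3 → 10 ≤ m →
      (SimpleGraph.pathGraph m).upperSierpinskiPackingChromaticNumber
        (completeBipartiteGraph (Fin 1) (Fin n)) ∈ ({6, 7, 8, 9} : Set ℕ∞)) ∧
    (3 < n → 35 ≤ m →
      (SimpleGraph.pathGraph m).upperSierpinskiPackingChromaticNumber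
        (completeBipartiteGraph (Fin 1) (Fin n)) ∈ ({7, 8, 9} : Set ℕ∞)) := by
  have upper : (SimpleGraph.pathGraph m).upperSierpinskiPackingChromaticNumber
      (completeBipartiteGraph (Fin 1) (Fin n)) ≤ 9 :=
    iSup_le fun f => (isPackingColoring_nineColoring f).packingChromaticNumber_le
  have lower : ∀ k : ℕ, (∀ c, ¬ (pathStar fun _ : Fin m =>
      (.inl 0 : Fin 1 ⊕ Fin n)).IsPackingColoring k c) →
      ((k + 1 : ℕ) : ℕ∞) ≤ (SimpleGraph.pathGraph m).upperSierpinskiPackingChromaticNumber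
        (completeBipartiteGraph (Fin 1) (Fin n)) := fun k hk =>
    (succ_le_packingChromaticNumber hk).trans
      (le_iSup (fun f => ((pathGraph m).sierpinskiProduct
        (completeBipartiteGraph (Fin 1) (Fin n)) f).packingChromaticNumber) _)
  refine ⟨le_antisymm ?_ ?_, upper, fun hn3 hm10 => ?_, fun hn4 hm35 => ?_⟩
  · exact (iInf_le _ (alternatingMap m n hn)).trans
      (isPackingColoring_alternatingMap hn).packingChromaticNumber_le
  · exact le_iInf fun f => succ_le_packingChromaticNumber (not_isPackingColoring_two hm hn f)
  -- For `n = 3` the condition `k ≤ n + 2` stops at five colors; `n > 3` allows six below.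
  · have h := lower 5 fun c hc => not_isSpineWord_five _
      (isSpineWord_of_isPackingColoring hc hm10 (by norm_num) (by omega))
    generalize (SimpleGraph.pathGraph m).upperSierpinskiPackingChromaticNumber
      (completeBipartiteGraph (Fin 1) (Fin n)) = x at h upper
    lift x to ℕ using ne_top_of_le_ne_top (by simp) upper
    norm_cast at h upper
    interval_cases x <;> simp
  · have h := lower 6 fun c hc => not_isSpineWord_six _
      (isSpineWord_of_isPackingColoring hc hm35 (by norm_num) (by omega))
    generalize (SimpleGraph.pathGraph m).upperSierpinskiPackingChromaticNumber
      (completeBipartiteGraph (Fin 1) (Fin n)) = x at h upper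
    lift x to ℕ using ne_top_of_le_ne_top (by simp) upper
    norm_cast at h upper
    interval_cases x <;> simp
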